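/- **Definitions.** Let $\mathcal H\subseteq[0,1]^{\mathcal X}$ and $k\ge 1$. For $V\subseteq[0,1]^n$, the one-inclusion graph $\mathcal G(V)$ is the hypergraph with vertex set $V$ whose hyperedges are the nonempty sets $e_{i,f}=\{v\in V: v_j=f_j\ \forall j\ne i\}$ for $i\in[n]$, $f:[n]\setminus\{i\}\to[0,1]$; the hyperedge in direction $i$ containing $v\in V$ is denoted $e_{i,v}$. A $k$-list orientation $\sigma$ of $\mathcal G(V)$ assigns to every hyperedge $e$ a set $\sigma(e)\subseteq e$ of at most $k$ vertices. For $\gamma\in(0,1)$, $\mathrm{outdeg}(v;\sigma,\gamma)$ is the number of $i\in[n]$ such that no $w\in\sigma(e_{i,v})$ satisfies $|w_i-v_i|\le\gamma$. The $(\gamma,k)$-OIG dimension $\mathbb D_{\gamma,k}(\mathcal H)\in\mathbb N\cup\{\infty\}$ is the supremum of all $n\in\mathbb N$ for which there are $S\in\mathcal X^n$ and a finite $V\subseteq\mathcal H|_S$ such that for every $k$-list orientation $\sigma$ of $\mathcal G(V)$ there is $v\in V$ with $\mathrm{outdeg}(v;\sigma,\gamma)\ge\frac{n}{2(k+1)}$.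 A distribution $\mathcal D$ on $\mathcal X\times[0,1]$ is realizable by $\mathcal H$ if for some $h\in\mathcal H$ one has $y=h(x)$ for $\mathcal D$-almost every $(x,y)$. A $k$-list hypothesis is a map $\mu:\mathcal X\to[0,1]^k$; its error is $\mathrm{err}_{\mathcal D}(\mu)=\mathbb E_{(x,y)\sim\mathcal D}\min_{j\le k}|\mu(x)_j-y|$. A $k$-list learner maps each finite sample $S\in(\mathcal X\times[0,1])^n$, $n\in\mathbb N$, to a $k$-list hypothesis. As usual, guarantees for a learner are asserted for those distributions along which its losses are random variables: the loss on $z_j$ of the hypothesis learned from $z_{i_1},\dots,z_{i_n}$ is a measurable function, up to a null set, of $(z_1,\dots,z_s)\sim\mathcal D^s$, for all $s,n,i,j$ (for discrete $\mathcal D$, with singletons of $\mathcal X$ measurable, this always holds). **Theorem (finite $(\gamma,k)$-OIG dimension is sufficient).** There are absolute constants $C>0$ and $c\in(0,1]$ such that for every measurable space $\mathcal X$, every $\mathcal H\subseteq[0,1]^{\mathcal X}$ and every $k\ge1$ there are $k$-list learners $\mathcal A_\gamma$ (one for each scale $\gamma$) and scales $g(n)\in(0,1)$, $n\in\mathbb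 N$, with the following properties. 1. Let $\gamma\in(0,1)$ with $\mathbb D_{\gamma,k}(\mathcal H)<\infty$. For every distribution $\mathcal D$ realizable by $\mathcal H$ along which $\mathcal A_\gamma$ has measurable losses, every $\delta\in(0,1)$ and $n\ge1$, with probability at least $1-\delta$ over $S\sim\mathcal D^n$, $$\mathrm{err}_{\mathcal D}(\mathcal A_\gamma(S))\le\gamma+C\cdot\frac{k\,\mathbb D_{\gamma,k}(\mathcal H)\log^2(n+1)+\log(1/\delta)}{n}.$$ 2. Let $\varepsilon,\delta\in(0,1)$, $\gamma=c\varepsilon$ and $d=\mathbb D_{\gamma,k}(\mathcal H)<\infty$. For every distribution $\mathcal D$ realizable by $\mathcal H$ along which $\mathcal A_\gamma$ has measurable losses and every $$n\ge C\cdot\frac{k\,d\,\log^2(2+kd/\varepsilon)+\log(1/\delta)}{\varepsilon},$$ with probability at least $1-\delta$ over $S\sim\mathcal D^n$, $\mathrm{err}_{\mathcal D}(\mathcal A_\gamma(S))\le\varepsilon$. 3. The statement in 2 also holds, with the same bound on $n$, for the single learner that does not depend on $\varepsilon$ and applies $\mathcal A_{g(n)}$ to samples of size $n$, for every realizable $\mathcal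 D$ along which all $\mathcal A_\gamma$, $\gamma\in(0,1)$, have measurable losses. -/

import Mathlib

open MeasureTheory

namespace ListRegression

/-- The restriction `H|_S` of a class `H ⊆ [0,1]^X` to a sequence `S ∈ X^n`. -/
def restrictClass {X : Type*} (H : Set (X → unitInterval)) {n : ℕ} (S : Fin n → X) :
    Set (Fin n → unitInterval) :=
  {v | ∃ h ∈ H, v = fun i => h (S i)}

/-- The hyperedge `e_{i,f}` of the one-inclusion graph with vertex set `V ⊆ [0,1]^n`. -/
def hyperedge {n : ℕ} (V : Set (Fin n → unitInterval)) (i : Fin n)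
    (f : {j : Fin n // j ≠ i} → unitInterval) : Set (Fin n → unitInterval) :=
  {v | v ∈ V ∧ ∀ j : {j : Fin n // j ≠ i}, v j = f j}

/-- The edge set of the one-inclusion graph with vertex set `V`: the nonempty hyperedges. -/
def oigEdges {n : ℕ} (V : Set (Fin n → unitInterval)) : Set (Set (Fin n → unitInterval)) :=
  {e | e.Nonempty ∧ ∃ i f, e = hyperedge V i f}

/-- The hyperedge `e_{i,v}` adjacent to the vertex `v` in direction `i`. -/
def edgeAt {n : ℕ} (V : Set (Fin n → unitInterval)) (i : Fin n) (v : Fin n → unitInterval) :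
    Set (Fin n → unitInterval) :=
  hyperedge V i (fun j => v j)

/-- `σ` is a `k`-list orientation of the one-inclusion graph with vertex set `V`: each edge is
sent to at most `k` of its vertices. (Values of `σ` outside the edge set are irrelevant.) -/
def IsListOrientation {n : ℕ} (k : ℕ) (V : Set (Fin n → unitInterval))
    (σ : Set (Fin n → unitInterval) → Finset (Fin n → unitInterval)) : Prop :=
  ∀ e ∈ oigEdges V, (σ e : Set (Fin n → unitInterval)) ⊆ e ∧ (σ e).card ≤ k

/-- The `γ`-scaled `k`-outdegree of `v`: the number of directions `i` such that no entry of the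
list `σ_i(e_{i,v})` is within `γ` of `v_i`. -/
noncomputable def outdeg {n : ℕ} (V : Set (Fin n → unitInterval))
    (σ : Set (Fin n → unitInterval) → Finset (Fin n → unitInterval)) (γ : ℝ)
    (v : Fin n → unitInterval) : ℕ :=
  Set.ncard {i : Fin n | ¬ ∃ w ∈ σ (edgeAt V i v), |(w i : ℝ) - (v i : ℝ)| ≤ γ}

/-- Some sequence of length `n` and some finite subgraph of the one-inclusion graph of the
restricted class (the one-inclusion graph induced on a finite vertex set `V`) are such that every
`k`-list orientation has a vertex of outdegree at least `n / (2(k+1))`. -/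
def OIGShatters {X : Type*} (H : Set (X → unitInterval)) (k : ℕ) (γ : ℝ) (n : ℕ) : Prop :=
  ∃ S : Fin n → X, ∃ V : Set (Fin n → unitInterval), V.Finite ∧ V ⊆ restrictClass H S ∧
    ∀ σ, IsListOrientation k V σ →
      ∃ v ∈ V, (n : ℝ) / (2 * ((k : ℝ) + 1)) ≤ (outdeg V σ γ v : ℝ)

/-- The `(γ,k)`-OIG dimension, with values in `ℕ ∪ {∞}`. -/
noncomputable def oigDim {X : Type*} (H : Set (X → unitInterval)) (k : ℕ) (γ : ℝ) : ℕ∞ :=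
  ⨆ n : {n : ℕ // OIGShatters H k γ n}, ((n : ℕ) : ℕ∞)

/-- The loss `min_j |μ_j - y|` of a list `μ` of `k` labels (repetitions allowed, so that shorter
nonempty lists are included). -/
noncomputable def listLoss {k : ℕ} (μ : Fin k → unitInterval) (y : unitInterval) : ℝ :=
  ⨅ j, |(μ j : ℝ) - (y : ℝ)|

/-- A (deterministic) `k`-list learner: it maps samples of any size to `k`-list hypotheses. -/
abbrev Learner (X : Type*) (k : ℕ) : Type _ :=
  (n : ℕ) → (Fin n → X × unitInterval) → X → Fin k → unitInterval

/-- The distribution `D` is realizable by `H`: for some `h ∈ H`, a draw `(x,y)` from `D` almost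
surely has `y = h x`. -/
def Realizable {X : Type*} [MeasurableSpace X] (H : Set (X → unitInterval))
    (D : Measure (X × unitInterval)) : Prop :=
  ∃ h ∈ H, ∀ᵐ z ∂D, z.2 = h z.1

/-- The expected loss of the list hypothesis `μ` under `D` is well defined and at most `b`. -/
def ErrorLE {X : Type*} [MeasurableSpace X] {k : ℕ} (D : Measure (X × unitInterval))
    (μ : X → Fin k → unitInterval) (b : ℝ) : Prop :=
  Integrable (fun z : X × unitInterval => listLoss (μ z.1) z.2) D ∧
    ∫ z, listLoss (μ z.1) z.2 ∂D ≤ b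

/-- With probability at least `1 - δ` over an i.i.d. sample `S ∼ D^n`, the output of the learner
has error at most `b` (the failure event has outer measure at most `δ`). -/
def LearnsWithin {X : Type*} [MeasurableSpace X] {k : ℕ} (A : Learner X k)
    (D : Measure (X × unitInterval)) (n : ℕ) (b δ : ℝ) : Prop :=
  (Measure.pi fun _ : Fin n => D) {S | ¬ ErrorLE D (A n S) b} ≤ ENNReal.ofReal δ

/-- The losses of the learner are random variables: for an i.i.d. sample `z ∼ D^s`, the loss on
an example `z_j` of the hypothesis learned from `z_{i_1}, …, z_{i_n}` is a measurable function of
`z`, up to a null set. -/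
def MeasurableAlong {X : Type*} [MeasurableSpace X] {k : ℕ} (A : Learner X k)
    (D : Measure (X × unitInterval)) : Prop :=
  ∀ (s n : ℕ) (i : Fin n → Fin s) (j : Fin s),
    AEMeasurable (fun z : Fin s → X × unitInterval =>
      listLoss (A n (fun t => z (i t)) (z j).1) (z j).2) (Measure.pi fun _ : Fin s => D)

/-- Every learner is measurable along every discrete distribution. -/
theorem measurableAlong_of_countable {X : Type*} [MeasurableSpace X] [MeasurableSingletonClass X]
    {k : ℕ} (A : Learner X k) (D : Measure (X × unitInterval)) [IsProbabilityMeasure D]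
    (C : Set (X × unitInterval)) (hC : C.Countable) (hD : ∀ᵐ z ∂D, z ∈ C) :
    MeasurableAlong A D := by
  intro s n i j
  have hP : (Set.univ.pi fun _ : Fin s => C).Countable := Set.countable_univ_pi fun _ => hC
  have hmem : ∀ᵐ z ∂(Measure.pi fun _ : Fin s => D), z ∈ Set.univ.pi fun _ : Fin s => C := by
    have : ∀ t : Fin s, ∀ᵐ z ∂(Measure.pi fun _ : Fin s => D), z t ∈ C := fun t =>
      (measurePreserving_eval (fun _ : Fin s => D) t).quasiMeasurePreserving.ae hD
    filter_upwards [ae_all_iff.2 this] with z hz t _ using hz t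
  rw [← Measure.restrict_eq_self_of_ae_mem hmem]
  refine aemeasurable_restrict_of_measurable_subtype hP.measurableSet ?_
  have := hP.to_subtype
  exact measurable_of_countable _

end ListRegression

open MeasureTheory

namespace ListRegression

/-! Let `d` be the dimension at scale `γ`. Length `d + 1` is not shattered, so finite subgraphs have
orientations of outdegree below `(d+1)/(2(k+1))`. By compactness they yield one predictor for the
whole class that, on `d + 1` points, errs at fewer than that many positions (`exists_predictor`).

Averaging over i.i.d. draws turns this into a weak learner: for every weighting of the sample, some
`d` examples produce `d + 1` lists whose average weighted failure is at most `1/(2(k+1))`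
(`exists_le_weighted_average`). Multiplicative weights boost it: with `T = O(k log n)` such choices,
each example is missed by less than a `1/(k+1)` fraction of all lists (`exists_boosted`).

Lists have no majority vote. Instead, any `k + 1` labels that are each missed by so few lists are
all hit by a common list, and by pigeonhole two of them share an entry. So these labels contain no
`k + 1` points that are `2γ`-separated, and `k` intervals of radius `γ` cover them
(`exists_aggregate`).

The result fits the sample at scale `γ` and depends on `T d = O(k d log n)` examples. A union bound
over selections of examples gives the error bound (`learnsWithin_of_compression`). The learner
reproduces its output when rerun on a padded compression set, so measurability of its own losses
suffices. The learner independent of `ε` uses a scale proportional to a nearly best attainable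
accuracy; no such accuracy exists only if the dimension vanishes at every scale, and then an exact
list does (`exists_exact_list`). -/

/-! ### The list loss. -/

theorem listLoss_nonneg {k : ℕ} (μ : Fin k → unitInterval) (y : unitInterval) :
    0 ≤ listLoss μ y :=
  Real.iInf_nonneg fun _ => abs_nonneg _

/-- A finite nonempty minimum is attained. For `k = 0` the infimum is `0` by convention and the
equivalence would fail for `γ ≥ 0`. -/
theorem listLoss_le_iff {k : ℕ} (hk : 1 ≤ k) (μ : Fin k → unitInterval) (y : unitInterval)
    (γ : ℝ) : listLoss μ y ≤ γ ↔ ∃ j, |(μ j : ℝ) - (y : ℝ)| ≤ γ := by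
  have : Nonempty (Fin k) := ⟨⟨0, hk⟩⟩
  constructor
  · intro h
    obtain ⟨j, hj⟩ := exists_eq_ciInf_of_finite (f := fun j => |(μ j : ℝ) - (y : ℝ)|)
    exact ⟨j, hj.trans_le h⟩
  · rintro ⟨j, hj⟩
    exact (ciInf_le (Set.finite_range _).bddBelow j).trans hj

theorem lt_listLoss_iff {k : ℕ} (hk : 1 ≤ k) (μ : Fin k → unitInterval) (y : unitInterval)
    (γ : ℝ) : γ < listLoss μ y ↔ ∀ j, γ < |(μ j : ℝ) - (y : ℝ)| := by
  rw [← not_le, listLoss_le_iff hk]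
  push Not
  rfl

theorem listLoss_le_one {k : ℕ} (hk : 1 ≤ k) (μ : Fin k → unitInterval) (y : unitInterval) :
    listLoss μ y ≤ 1 := by
  rw [listLoss_le_iff hk]
  refine ⟨⟨0, hk⟩, abs_le.2 ⟨?_, ?_⟩⟩ <;>
    linarith [(μ ⟨0, hk⟩).2.1, (μ ⟨0, hk⟩).2.2, y.2.1, y.2.2]

theorem isClosed_listLoss_le {k : ℕ} (hk : 1 ≤ k) (y : unitInterval) (γ : ℝ) :
    IsClosed {μ : Fin k → unitInterval | listLoss μ y ≤ γ} := by
  simp only [listLoss_le_iff hk, Set.ofPred_exists]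
  exact isClosed_iUnion_of_finite fun j => isClosed_le (by fun_prop) continuous_const

/-! ### Transductive prediction from orientations. -/

open scoped Classical in
/-- The set of points lying in fewer than `c` members of a finite family of open sets is closed. -/
theorem isClosed_card_lt {Ω ι : Type*} [TopologicalSpace Ω] [Fintype ι] (U : ι → Set Ω)
    (hU : ∀ i, IsOpen (U i)) (a c : ℕ) :
    IsClosed {ω | a * (Finset.univ.filter fun i => ω ∈ U i).card < c} := by
  rw [← isOpen_compl_iff, isOpen_iff_mem_nhds]
  intro ω hω
  have h : ∀ᶠ ω' in nhds ω, ∀ i, ω ∈ U i → ω' ∈ U i := by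
    rw [Filter.eventually_all]
    intro i
    by_cases hi : ω ∈ U i
    · filter_upwards [(hU i).mem_nhds hi] with ω' h _ using h
    · exact Filter.Eventually.of_forall fun _ h => absurd h hi
  filter_upwards [h] with ω' h
  simp only [Set.mem_compl_iff, Set.mem_ofPred_eq, not_lt] at hω ⊢
  refine hω.trans (Nat.mul_le_mul_left _ (Finset.card_le_card fun i => ?_))
  simpa using h i

theorem exists_list_of_card_le {k : ℕ} {α β : Type*} [Nonempty β] (F : Finset α) (hF : F.card ≤ k)
    (φ : α → β) : ∃ μ : Fin k → β, ∀ w ∈ F, ∃ j, μ j = φ w := by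
  refine ⟨fun j => if h : (j : ℕ) < F.card then φ (F.equivFin.symm ⟨j, h⟩)
    else Classical.arbitrary β, fun w hw => ?_⟩
  refine ⟨Fin.castLE hF (F.equivFin ⟨w, hw⟩), ?_⟩
  simp

open scoped Classical in
/-- Below the shattering threshold, there is a transductive predictor that makes few mistakes at
scale `γ` on every member of the (possibly infinite) restricted class. -/
theorem exists_predictor {X : Type*} {H : Set (X → unitInterval)} {k n : ℕ} {γ : ℝ} (hk : 1 ≤ k)
    (hn : ¬ OIGShatters H k γ n) (S : Fin n → X) :
    ∃ P : (a : Fin n) → ({j : Fin n // j ≠ a} → unitInterval) → Fin k → unitInterval,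
      ∀ h ∈ H, 2 * (k + 1) * (Finset.univ.filter fun a : Fin n =>
        γ < listLoss (P a fun j => h (S j)) (h (S a))).card < n := by
  -- Predictors form a product of copies of `[0,1]`, hence a compact space, and few strict mistakes
  -- on a given `h` is a closed condition. Finitely many `h` at a time are enough.
  have key : ((Set.univ : Set ((a : Fin n) → ({j : Fin n // j ≠ a} → unitInterval) →
      Fin k → unitInterval)) ∩ ⋂ h : H, {P | 2 * (k + 1) * (Finset.univ.filter fun a : Fin n =>
        P ∈ {P | γ < listLoss (P a fun j => h.1 (S j)) (h.1 (S a))}).card < n}).Nonempty := by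
    refine isCompact_univ.inter_iInter_nonempty _ (fun h => isClosed_card_lt _ (fun a => ?_) _ _)
      (fun u => ?_)
    · simp only [lt_listLoss_iff hk, Set.ofPred_forall]
      exact isOpen_iInter_of_finite fun j => isOpen_lt continuous_const (by fun_prop)
    · set V : Set (Fin n → unitInterval) := (fun h : H => fun i => h.1 (S i)) '' (u : Set H)
        with hV
      have hVH : V ⊆ restrictClass H S := by
        rintro _ ⟨h, -, rfl⟩
        exact ⟨h.1, h.2, rfl⟩
      have hσ : ∃ σ, IsListOrientation k V σ ∧
          ∀ v ∈ V, (outdeg V σ γ v : ℝ) < (n : ℝ) / (2 * ((k : ℝ) + 1)) := by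
        by_contra hcon
        push Not at hcon
        exact hn ⟨S, V, u.finite_toSet.image _, hVH, hcon⟩
      obtain ⟨σ, hσ, hout⟩ := hσ
      -- The list at an edge consists of the `a`-th coordinates of the vertices chosen by `σ`.
      have hP : ∀ (a : Fin n) (f : {j : Fin n // j ≠ a} → unitInterval),
          ∃ μ : Fin k → unitInterval, (hyperedge V a f).Nonempty →
            ∀ w ∈ σ (hyperedge V a f), ∃ j, μ j = w a := by
        intro a f
        by_cases hne : (hyperedge V a f).Nonempty
        · obtain ⟨μ, hμ⟩ := exists_list_of_card_le (σ (hyperedge V a f))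
            (hσ _ ⟨hne, a, f, rfl⟩).2 (fun w => w a)
          exact ⟨μ, fun _ => hμ⟩
        · exact ⟨fun _ => 0, fun h => absurd h hne⟩
      choose P hP using hP
      refine ⟨P, trivial, Set.mem_iInter₂.2 fun h hh => ?_⟩
      have hv : (fun i => h.1 (S i)) ∈ V := ⟨h, hh, rfl⟩
      have h1 := hout _ hv
      rw [lt_div_iff₀ (by positivity)] at h1
      have h2 : (Finset.univ.filter fun a : Fin n =>
          P ∈ {P : (a : Fin n) → ({j : Fin n // j ≠ a} → unitInterval) → Fin k → unitInterval |
            γ < listLoss (P a fun j => h.1 (S j)) (h.1 (S a))}).card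
          ≤ outdeg V σ γ (fun i => h.1 (S i)) := by
        rw [← Set.ncard_coe_finset]
        refine Set.ncard_le_ncard (fun a ha => ?_) (Set.toFinite _)
        simp only [Set.mem_ofPred_eq, Finset.coe_filter, Finset.mem_univ, true_and,
          lt_listLoss_iff hk] at ha ⊢
        rintro ⟨w, hw, hle⟩
        obtain ⟨j, hj⟩ := hP a (fun j => h.1 (S j)) ⟨_, hv, fun _ => rfl⟩ w hw
        have := ha j
        rw [hj] at this
        exact absurd hle (not_le.2 this)
      have h3 : (2 * (k + 1) * outdeg V σ γ (fun i => h.1 (S i)) : ℕ) < n := by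
        have : ((2 * (k + 1) * outdeg V σ γ (fun i => h.1 (S i)) : ℕ) : ℝ) < n := by
          push_cast
          linarith
        exact_mod_cast this
      exact (Nat.mul_le_mul_left _ h2).trans_lt h3
  obtain ⟨P, -, hP⟩ := key
  exact ⟨P, fun h hh => Set.mem_iInter.1 hP ⟨h, hh⟩⟩

/-! ### Aggregation of lists. -/

/-- A finite set of labels without `k + 1` points at pairwise distance more than `2γ` is covered
by `k` intervals of radius `γ`. -/
theorem exists_cover_of_finset {γ : ℝ} (hγ : 0 ≤ γ) (k : ℕ) (Y : Finset unitInterval)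
    (hY : ∀ p : Fin (k + 1) → unitInterval, (∀ i, p i ∈ Y) →
      ∃ i j, i < j ∧ (p j : ℝ) - p i ≤ 2 * γ) :
    ∃ μ : Fin k → unitInterval, ∀ y ∈ Y, ∃ j, |(μ j : ℝ) - (y : ℝ)| ≤ γ := by
  induction k generalizing Y with
  | zero =>
    refine ⟨Fin.elim0, fun y hy => ?_⟩
    obtain ⟨i, j, hij, -⟩ := hY (fun _ => y) fun _ => hy
    omega
  | succ k ih =>
    rcases Y.eq_empty_or_nonempty with rfl | hne
    · exact ⟨fun _ => 0, by simp⟩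
    set y₀ := Y.min' hne
    -- Greedy cover from the left: a separated family beyond `y₀ + 2γ` would be prolonged by `y₀`.
    obtain ⟨μ, hμ⟩ := ih (Y.filter fun y => (y₀ : ℝ) + 2 * γ < y) (by
      intro p hp
      simp only [Finset.mem_filter] at hp
      obtain ⟨i, j, hij, hle⟩ := hY (Fin.cons y₀ p) (by
        intro i
        refine Fin.cases ?_ (fun i => ?_) i
        · exact Y.min'_mem hne
        · exact (hp i).1)
      induction j using Fin.cases with
      | zero => exact absurd hij (by simp)
      | succ j =>
        induction i using Fin.cases with
        | zero =>
          simp only [Fin.cons_succ, Fin.cons_zero] at hle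
          linarith [(hp j).2]
        | succ i => exact ⟨i, j, by simpa using hij, by simpa using hle⟩)
    -- Truncating the centre at `1` loses no labels, since they are at most `1`.
    refine ⟨Fin.cons ⟨min (y₀ + γ) 1, le_min (add_nonneg y₀.2.1 hγ) zero_le_one,
      min_le_right _ _⟩ μ, fun y hy => ?_⟩
    by_cases h : (y₀ : ℝ) + 2 * γ < y
    · obtain ⟨j, hj⟩ := hμ y (by simp [hy, h])
      exact ⟨j.succ, by simpa using hj⟩
    · refine ⟨0, ?_⟩
      have h0 : (y₀ : ℝ) ≤ y := Y.min'_le y hy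
      have h1 := y.2.2
      simp only [Fin.cons_zero]
      rw [abs_le]
      rcases min_cases ((y₀ : ℝ) + γ) 1 with ⟨h, h'⟩ | ⟨h, h'⟩ <;> rw [h] <;>
        constructor <;> linarith

open scoped Classical in
/-- Lists can be aggregated: one list is within `γ` of every label that all but less than a
`1/(k+1)` fraction of the given lists are within `γ` of. -/
theorem exists_aggregate {ι : Type*} [Fintype ι] {k : ℕ} (hk : 1 ≤ k) {γ : ℝ} (hγ : 0 ≤ γ)
    (L : ι → Fin k → unitInterval) :
    ∃ μ : Fin k → unitInterval, ∀ y, (k + 1) * (Finset.univ.filter fun i =>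
      γ < listLoss (L i) y).card < Fintype.card ι → listLoss μ y ≤ γ := by
  set Y : Set unitInterval := {y | (k + 1) * (Finset.univ.filter fun i =>
      γ < listLoss (L i) y).card < Fintype.card ι}
  have key : ((Set.univ : Set (Fin k → unitInterval)) ∩
      ⋂ y : Y, {μ | listLoss μ y.1 ≤ γ}).Nonempty := by
    refine isCompact_univ.inter_iInter_nonempty _ (fun y => isClosed_listLoss_le hk _ _)
      (fun u => ?_)
    obtain ⟨μ, hμ⟩ := exists_cover_of_finset hγ k (u.image Subtype.val) (by
      intro p hp
      have hpY : ∀ i, p i ∈ Y := by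
        intro i
        obtain ⟨y, -, hy⟩ := Finset.mem_image.1 (hp i)
        exact hy ▸ y.2
      -- The `k + 1` sets of failing lists each have fewer than `1/(k+1)` of the indices, so they
      -- cannot cover `ι`.
      have hex : ∃ t, ∀ i, listLoss (L t) (p i) ≤ γ := by
        by_contra hcon
        push Not at hcon
        have hcov : (Finset.univ : Finset ι) ⊆ Finset.univ.biUnion fun i : Fin (k + 1) =>
            Finset.univ.filter fun t => γ < listLoss (L t) (p i) := by
          intro t _
          simpa using hcon t
        have h1 := (Finset.card_le_card hcov).trans Finset.card_biUnion_le
        rw [Finset.card_univ] at h1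
        have h2 : ∑ i : Fin (k + 1), (k + 1) * (Finset.univ.filter fun t =>
            γ < listLoss (L t) (p i)).card < ∑ _i : Fin (k + 1), Fintype.card ι :=
          Finset.sum_lt_sum_of_nonempty ⟨0, Finset.mem_univ _⟩ fun i _ => hpY i
        rw [← Finset.mul_sum] at h2
        simp only [Finset.sum_const, Finset.card_univ, Fintype.card_fin, smul_eq_mul] at h2
        exact absurd (Nat.mul_le_mul_left (k + 1) h1) (not_le.2 h2)
      obtain ⟨t, ht⟩ := hex
      simp only [listLoss_le_iff hk] at ht
      choose φ hφ using ht
      obtain ⟨i, j, hij, he⟩ := Fintype.exists_ne_map_eq_of_card_lt φ (by simp)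
      have hi := abs_le.1 (hφ i)
      have hj := abs_le.1 (hφ j)
      rw [he] at hi
      rcases lt_or_gt_of_ne hij with h | h
      · exact ⟨i, j, h, by linarith⟩
      · exact ⟨j, i, h, by linarith⟩)
    refine ⟨μ, trivial, Set.mem_iInter₂.2 fun y hy => ?_⟩
    exact (listLoss_le_iff hk _ _ _).2 (hμ y.1 (Finset.mem_image_of_mem _ hy))
  obtain ⟨μ, -, hμ⟩ := key
  exact ⟨μ, fun y hy => Set.mem_iInter.1 hμ ⟨y, hy⟩⟩

/-! ### Weak learning and boosting. -/

/-- Leave-one-out averaging: if every sequence of length `d + 1` has total cost at most `B`, then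
for every weighting of the points some sequence of length `d` has average cost at most `B`. -/
theorem exists_le_weighted_average {α : Type*} [Fintype α] {d : ℕ} {w : α → ℝ}
    (hw : ∀ j, 0 ≤ w j) (hW : 0 < ∑ j, w j) {b : Fin (d + 1) → α → (Fin d → α) → ℝ} {B : ℝ}
    (hb : ∀ s : Fin (d + 1) → α, ∑ a, b a (s a) (a.removeNth s) ≤ B) :
    ∃ u : Fin d → α, ∑ j, w j * ∑ a, b a j u ≤ B * ∑ j, w j := by
  by_contra hcon
  push Not at hcon
  have hsum : ∀ m : ℕ, ∑ u : Fin m → α, ∏ t, w (u t) = (∑ j, w j) ^ m := fun m =>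
    (Fintype.sum_pow w m).symm
  have h1 : B * (∑ j, w j) ^ (d + 1)
      < ∑ u : Fin d → α, (∏ t, w (u t)) * ∑ j, w j * ∑ a, b a j u := by
    have h0 : B * (∑ j, w j) ^ (d + 1)
        = ∑ u : Fin d → α, (∏ t, w (u t)) * (B * ∑ j, w j) := by
      rw [← Finset.sum_mul, hsum]
      ring
    rw [h0]
    refine Finset.sum_lt_sum (fun u _ => mul_le_mul_of_nonneg_left (hcon u).le
      (Finset.prod_nonneg fun t _ => hw _)) ?_
    -- Strictness needs one `u` of positive product weight; otherwise all these weights vanish,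
    -- although they sum to `(∑ w) ^ d > 0`.
    by_contra hno
    push Not at hno
    have hz : ∀ u : Fin d → α, ∏ t, w (u t) = 0 := by
      intro u
      by_contra hne
      have hpos := lt_of_le_of_ne (Finset.prod_nonneg fun t _ => hw (u t)) (Ne.symm hne)
      exact absurd (hno u (Finset.mem_univ _)) (not_le.2 (mul_lt_mul_of_pos_left (hcon u) hpos))
    have := hsum d
    rw [Finset.sum_eq_zero fun u _ => hz u] at this
    exact (pow_pos hW d).ne this
  -- An i.i.d. sequence of length `d + 1` is an independent pair: its `a`-th entry and the rest.
  have h2 : ∑ u : Fin d → α, (∏ t, w (u t)) * ∑ j, w j * ∑ a, b a j u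
      = ∑ s : Fin (d + 1) → α, (∏ t, w (s t)) * ∑ a, b a (s a) (a.removeNth s) := by
    have hL : ∀ u : Fin d → α, (∏ t, w (u t)) * ∑ j, w j * ∑ a, b a j u
        = ∑ a, ∑ j, (∏ t, w (u t)) * (w j * b a j u) := by
      intro u
      simp only [Finset.mul_sum]
      exact Finset.sum_comm
    simp only [hL]
    simp only [Finset.mul_sum]
    rw [Finset.sum_comm, Finset.sum_comm (s := (Finset.univ : Finset (Fin (d + 1) → α)))]
    refine Finset.sum_congr rfl fun a _ => ?_
    rw [← (Fin.insertNthEquiv (fun _ => α) a).sum_comp, Fintype.sum_prod_type_right]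
    refine Finset.sum_congr rfl fun u _ => Finset.sum_congr rfl fun j _ => ?_
    rw [Fin.prod_univ_succAbove _ a]
    have hr : a.removeNth (Fin.insertNthEquiv (fun _ => α) a (j, u)) = u :=
      Fin.removeNth_insertNth (α := fun _ => α) a j u
    rw [hr]
    simp only [Fin.insertNthEquiv_apply, Fin.insertNth_apply_same, Fin.insertNth_apply_succAbove]
    ring
  have h3 : ∑ s : Fin (d + 1) → α, (∏ t, w (s t)) * ∑ a, b a (s a) (a.removeNth s)
      ≤ B * (∑ j, w j) ^ (d + 1) := by
    rw [← hsum, Finset.mul_sum]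
    refine Finset.sum_le_sum fun s _ => ?_
    rw [mul_comm B]
    exact mul_le_mul_of_nonneg_left (hb s) (Finset.prod_nonneg fun t _ => hw _)
  linarith

/-- Multiplicative weights: if for every weighting of the points some `u` has average cost at most
`θ`, then the exponential potential of suitable `u₁, …, u_T` grows at rate at most `1 + θ`. -/
theorem exists_potential_le {α U : Type*} [Fintype α] [Nonempty α] {ℓ : U → α → ℝ} {θ : ℝ}
    (hθ : 0 ≤ θ) (h0 : ∀ u j, 0 ≤ ℓ u j) (h1 : ∀ u j, ℓ u j ≤ 1)
    (hweak : ∀ w : α → ℝ, (∀ j, 0 < w j) → ∃ u, ∑ j, w j * ℓ u j ≤ θ * ∑ j, w j) (T : ℕ) :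
    ∃ u : Fin T → U, ∑ j, (2 : ℝ) ^ (∑ t, ℓ (u t) j) ≤ Fintype.card α * (1 + θ) ^ T := by
  induction T with
  | zero => exact ⟨Fin.elim0, by simp⟩
  | succ T ih =>
    obtain ⟨u, hu⟩ := ih
    -- The weights are the current potentials, concentrated on the points missed most.
    obtain ⟨v, hv⟩ := hweak (fun j => (2 : ℝ) ^ (∑ t, ℓ (u t) j)) (fun j => by positivity)
    refine ⟨Fin.cons v u, ?_⟩
    have hstep : ∀ j, (2 : ℝ) ^ (∑ t, ℓ ((Fin.cons v u : Fin (T + 1) → U) t) j)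
        ≤ 2 ^ (∑ t, ℓ (u t) j) + 2 ^ (∑ t, ℓ (u t) j) * ℓ v j := by
      intro j
      have hb : (2 : ℝ) ^ ℓ v j ≤ 1 + ℓ v j := by
        have := rpow_one_add_le_one_add_mul_self (s := 1) (by norm_num) (h0 v j) (h1 v j)
        norm_num at this
        exact this
      rw [Fin.sum_univ_succ]
      simp only [Fin.cons_zero, Fin.cons_succ]
      rw [Real.rpow_add (by norm_num)]
      nlinarith [Real.rpow_pos_of_pos (show (0 : ℝ) < 2 by norm_num) (∑ t, ℓ (u t) j)]
    calc _ ≤ ∑ j, ((2 : ℝ) ^ (∑ t, ℓ (u t) j) + 2 ^ (∑ t, ℓ (u t) j) * ℓ v j) :=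
          Finset.sum_le_sum fun j _ => hstep j
      _ ≤ (1 + θ) * ∑ j, (2 : ℝ) ^ (∑ t, ℓ (u t) j) := by
          rw [Finset.sum_add_distrib]
          linarith
      _ ≤ (1 + θ) * (Fintype.card α * (1 + θ) ^ T) := by gcongr
      _ = _ := by ring

/-- One point's potential is at most the total, so its loss `s` satisfies `s log 2 ≤ log |α| +
T/(2(k+1))`. The constant `8` then gives `(k+1) s log 2 < (1/8 + 1/2) T`, and `5/8 < log 2`. The `+
1` in the logarithm forces `T > 0`. -/
theorem exists_boosted {α U : Type*} [Fintype α] {ℓ : U → α → ℝ} {k T : ℕ}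
    (h0 : ∀ u j, 0 ≤ ℓ u j) (h1 : ∀ u j, ℓ u j ≤ 1)
    (hweak : ∀ w : α → ℝ, (∀ j, 0 < w j) → 0 < ∑ j, w j →
      ∃ u, ∑ j, w j * ℓ u j ≤ 1 / (2 * ((k : ℝ) + 1)) * ∑ j, w j)
    [Nonempty α]
    (hT : 8 * ((k : ℝ) + 1) * Real.log (Fintype.card α + 1) ≤ T) :
    ∃ u : Fin T → U, ∀ j, ((k : ℝ) + 1) * ∑ t, ℓ (u t) j < T := by
  obtain ⟨u, hu⟩ := exists_potential_le (θ := 1 / (2 * ((k : ℝ) + 1))) (by positivity) h0 h1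
    (fun w hw => hweak w hw (Finset.sum_pos (fun j _ => hw j) Finset.univ_nonempty)) T
  refine ⟨u, fun j => ?_⟩
  have hk : (0 : ℝ) < (k : ℝ) + 1 := by positivity
  have hn : (0 : ℝ) < Fintype.card α := by exact_mod_cast Fintype.card_pos
  have h2 : (2 : ℝ) ^ (∑ t, ℓ (u t) j)
      ≤ Fintype.card α * (1 + 1 / (2 * ((k : ℝ) + 1))) ^ T :=
    (Finset.single_le_sum (f := fun j => (2 : ℝ) ^ (∑ t, ℓ (u t) j))
      (fun j _ => by positivity) (Finset.mem_univ j)).trans hu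
  have h3 := Real.log_le_log (by positivity) h2
  rw [Real.log_rpow (by norm_num), Real.log_mul hn.ne' (by positivity), Real.log_pow] at h3
  have h4 : Real.log (1 + 1 / (2 * ((k : ℝ) + 1))) ≤ 1 / (2 * ((k : ℝ) + 1)) := by
    have := Real.log_le_sub_one_of_pos (show 0 < 1 + 1 / (2 * ((k : ℝ) + 1)) by positivity)
    linarith
  have h5 : Real.log (Fintype.card α) < Real.log (Fintype.card α + 1) :=
    Real.log_lt_log hn (by linarith)
  have h6 : 0 < Real.log (Fintype.card α + 1) := Real.log_pos (by linarith)
  have h7 : (T : ℝ) * Real.log (1 + 1 / (2 * ((k : ℝ) + 1)))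
      ≤ T * (1 / (2 * ((k : ℝ) + 1))) := by gcongr
  set s := ∑ t, ℓ (u t) j
  have h8 : ((k : ℝ) + 1) * s * Real.log 2
      < ((k : ℝ) + 1) * Real.log (Fintype.card α + 1) + T / 2 := by
    have : ((k : ℝ) + 1) * (s * Real.log 2)
        < ((k : ℝ) + 1) * (Real.log (Fintype.card α + 1) + T * (1 / (2 * ((k : ℝ) + 1)))) := by
      gcongr
      linarith
    calc _ = ((k : ℝ) + 1) * (s * Real.log 2) := by ring
      _ < _ := this
      _ = _ := by field_simp
  have hTpos : (0 : ℝ) < T := lt_of_lt_of_le (by positivity) hT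
  have hlog2 := Real.log_two_gt_d9
  by_contra hcon
  push Not at hcon
  nlinarith

/-! ### The compressing learner. -/

/-- The `d + 1` lists predicted for `x` from a labelled sequence `u` of length `d`, one for each
position at which `x` can be inserted. -/
def leaveOneOutList {X : Type*} {k d : ℕ}
    (P : (Fin (d + 1) → X) → (a : Fin (d + 1)) →
      ({j : Fin (d + 1) // j ≠ a} → unitInterval) → Fin k → unitInterval)
    (u : Fin d → X × unitInterval) (x : X) (a : Fin (d + 1)) : Fin k → unitInterval :=
  P (a.insertNth (α := fun _ => X) x fun t => (u t).1) a
    fun j => a.insertNth (α := fun _ => unitInterval) 0 (fun t => (u t).2) j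

open scoped Classical in
/-- On a realizable sample, `T = O(k log n)` subsequences of length `d` can be chosen so that
for each example all but less than a `1/(k+1)` fraction of the predicted lists are accurate. -/
theorem exists_boosted_indices {X : Type*} {k d n T : ℕ} {γ : ℝ} (hn : 1 ≤ n)
    {h : X → unitInterval}
    {P : (Fin (d + 1) → X) → (a : Fin (d + 1)) →
      ({j : Fin (d + 1) // j ≠ a} → unitInterval) → Fin k → unitInterval}
    (hP : ∀ S : Fin (d + 1) → X, 2 * (k + 1) * (Finset.univ.filter fun a =>
        γ < listLoss (P S a fun j => h (S j)) (h (S a))).card < d + 1)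
    (hT : 8 * ((k : ℝ) + 1) * Real.log (n + 1) ≤ T)
    (S : Fin n → X × unitInterval) (hS : ∀ t, (S t).2 = h (S t).1) :
    ∃ i : Fin T → Fin d → Fin n, ∀ j, (k + 1) * (Finset.univ.filter fun p : Fin T × Fin (d + 1) =>
      γ < listLoss (leaveOneOutList P (fun t => S (i p.1 t)) (S j).1 p.2) (S j).2).card
        < Fintype.card (Fin T × Fin (d + 1)) := by
  have : Nonempty (Fin n) := ⟨⟨0, hn⟩⟩
  set b : Fin (d + 1) → Fin n → (Fin d → Fin n) → ℝ := fun a j u =>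
    if γ < listLoss (leaveOneOutList P (fun t => S (u t)) (S j).1 a) (S j).2 then 1 else 0 with hbdef
  have hb0 : ∀ a j u, 0 ≤ b a j u := fun a j u => by simp only [hbdef]; split_ifs <;> norm_num
  have hb1 : ∀ a j u, b a j u ≤ 1 := fun a j u => by simp only [hbdef]; split_ifs <;> norm_num
  have hd : (0 : ℝ) < (d : ℝ) + 1 := by positivity
  have hk : (0 : ℝ) < (k : ℝ) + 1 := by positivity
  have hB : ∀ s : Fin (d + 1) → Fin n,
      ∑ a, b a (s a) (a.removeNth s) ≤ ((d : ℝ) + 1) / (2 * ((k : ℝ) + 1)) := by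
    intro s
    -- Reinserting the omitted point restores the sequence `s`, with labels given by `h`.
    have hlist : ∀ a, leaveOneOutList P (fun t => S (a.removeNth s t)) (S (s a)).1 a
        = P (fun t => (S (s t)).1) a fun j => h (S (s j)).1 := by
      intro a
      have e1 : a.insertNth (α := fun _ => X) (S (s a)).1 (fun t => (S (a.removeNth s t)).1)
          = fun t => (S (s t)).1 := by
        funext t
        refine Fin.succAboveCases a ?_ (fun t => ?_) t <;> simp [Fin.removeNth]
      have e2 : (fun j : {j : Fin (d + 1) // j ≠ a} =>
          a.insertNth (α := fun _ => unitInterval) 0 (fun t => (S (a.removeNth s t)).2) j)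
          = fun j : {j : Fin (d + 1) // j ≠ a} => h (S (s j)).1 := by
        funext j
        obtain ⟨t, ht⟩ := Fin.exists_succAbove_eq j.2
        rw [← ht]
        simp [Fin.removeNth, hS]
      rw [leaveOneOutList, e1, e2]
    have hc := hP fun t => (S (s t)).1
    have hc' : 2 * ((k : ℝ) + 1) * ((Finset.univ.filter fun a =>
        γ < listLoss (P (fun t => (S (s t)).1) a fun j => h (S (s j)).1)
          (h (S (s a)).1)).card : ℝ) < (d : ℝ) + 1 := by exact_mod_cast hc
    have hsum : ∑ a, b a (s a) (a.removeNth s) = ((Finset.univ.filter fun a =>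
        γ < listLoss (P (fun t => (S (s t)).1) a fun j => h (S (s j)).1)
          (h (S (s a)).1)).card : ℝ) := by
      simp only [hbdef, hlist, hS]
      rw [Finset.sum_boole]
    rw [hsum, le_div_iff₀ (by positivity)]
    linarith
  obtain ⟨i, hi⟩ := exists_boosted (α := Fin n) (U := Fin d → Fin n) (k := k) (T := T)
    (ℓ := fun u j => (∑ a, b a j u) / ((d : ℝ) + 1))
    (fun u j => div_nonneg (Finset.sum_nonneg fun a _ => hb0 a j u) hd.le)
    (fun u j => by
      rw [div_le_one hd]
      calc ∑ a, b a j u ≤ ∑ _a : Fin (d + 1), (1 : ℝ) := Finset.sum_le_sum fun a _ => hb1 a j u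
        _ = _ := by simp)
    (fun w hw hW => by
      obtain ⟨u, hu⟩ := exists_le_weighted_average (fun j => (hw j).le) hW hB
      refine ⟨u, ?_⟩
      have : ∑ j, w j * ((∑ a, b a j u) / ((d : ℝ) + 1))
          = (∑ j, w j * ∑ a, b a j u) / ((d : ℝ) + 1) := by
        rw [Finset.sum_div]
        exact Finset.sum_congr rfl fun j _ => by ring
      rw [this, div_le_iff₀ hd]
      calc _ ≤ _ := hu
        _ = _ := by ring)
    (by simpa using hT)
  refine ⟨i, fun j => ?_⟩
  have hj := hi j
  rw [← Finset.sum_div, mul_div_assoc', div_lt_iff₀ hd] at hj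
  have hcard : ∑ t, ∑ a, b a j (i t) = ((Finset.univ.filter fun p : Fin T × Fin (d + 1) =>
      γ < listLoss (leaveOneOutList P (fun t => S (i p.1 t)) (S j).1 p.2) (S j).2).card : ℝ) := by
    rw [← Finset.sum_boole, Fintype.sum_prod_type]
  rw [hcard] at hj
  simp only [Fintype.card_prod, Fintype.card_fin]
  exact_mod_cast hj

/-- A selection of `m` indices, prolonged to a selection of `n` indices by the constant
index `0`. -/
def padIndex {m n : ℕ} (hn : 0 < n) (i : Fin m → Fin n) (t : Fin n) : Fin n :=
  if h : (t : ℕ) < m then i ⟨t, h⟩ else ⟨0, hn⟩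

open scoped Classical in
/-- There is a learner that is accurate at scale `γ` on its sample, and whose output does not
change when the sample is replaced by a suitable small part of it. -/
theorem exists_compressing_learner {X : Type*} {H : Set (X → unitInterval)} {k d : ℕ} {γ : ℝ}
    (hk : 1 ≤ k) (hγ : 0 ≤ γ) (hd : ¬ OIGShatters H k γ (d + 1)) (T : ℕ → ℕ)
    (hT : ∀ n : ℕ, 8 * ((k : ℝ) + 1) * Real.log (n + 1) ≤ T n) :
    ∃ A : Learner X k, (d = 0 → ∀ n S S', A n S = A n S') ∧
      ∀ (n : ℕ) (hn : 0 < n), T n * d ≤ n → ∀ S : Fin n → X × unitInterval,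
        (∃ h ∈ H, ∀ t, (S t).2 = h (S t).1) →
        ∃ i : Fin (T n * d) → Fin n, A n S = A n (fun t => S (padIndex hn i t)) ∧
          ∀ t, listLoss (A n S (S t).1) (S t).2 ≤ γ := by
  choose P hP using fun S : Fin (d + 1) → X => exists_predictor hk hd S
  choose ρ hρ using fun (T : ℕ) (v : Fin (T * d) → X × unitInterval) (x : X) =>
    exists_aggregate (ι := Fin T × Fin (d + 1)) hk hγ fun p =>
      leaveOneOutList P (fun s => v (finProdFinEquiv (p.1, s))) x p.2
  let good (n : ℕ) (S : Fin n → X × unitInterval) (i : Fin (T n * d) → Fin n) : Prop :=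
    ∀ t, listLoss (ρ (T n) (fun s => S (i s)) (S t).1) (S t).2 ≤ γ
  -- The leading block is tried before any search. A padded compression set starts with a good block
  -- and contains only examples of `S`, so the learner returns the same hypothesis on it.
  let A : Learner X k := fun n S =>
    if h0 : T n * d ≤ n then
      if good n S (Fin.castLE h0) then ρ (T n) (fun s => S (Fin.castLE h0 s))
      else if h : ∃ i, good n S i then ρ (T n) (fun s => S (h.choose s))
      else ρ (T n) (fun s => S (Fin.castLE h0 s))
    else fun _ _ => 0
  refine ⟨A, ?_, ?_⟩
  · rintro rfl n S S'
    have h0 : T n * 0 ≤ n := by simp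
    have hsub : ∀ v v' : Fin (T n * 0) → X × unitInterval, v = v' := fun v v' =>
      funext fun s => absurd s.2 (by simp)
    have hA : ∀ S, A n S = ρ (T n) (fun s => S (Fin.castLE h0 s)) := by
      intro S
      simp only [A, dif_pos h0]
      split_ifs
      · rfl
      · exact congrArg _ (hsub _ _)
      · rfl
    rw [hA, hA]
    exact congrArg _ (hsub _ _)
  · intro n hn h0 S hS
    obtain ⟨h, hH, hS⟩ := hS
    have hex : ∃ i, good n S i := by
      obtain ⟨i, hi⟩ := exists_boosted_indices hn (fun S => hP S h hH) (hT n) S hS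
      refine ⟨fun s => i (finProdFinEquiv.symm s).1 (finProdFinEquiv.symm s).2, fun t => ?_⟩
      refine hρ (T n) _ (S t).1 (S t).2 ?_
      simpa only [Equiv.symm_apply_apply] using hi t
    have hA : ∃ i, good n S i ∧ A n S = ρ (T n) (fun s => S (i s)) := by
      by_cases hg : good n S (Fin.castLE h0)
      · exact ⟨_, hg, by simp only [A, dif_pos h0, if_pos hg]⟩
      · exact ⟨_, hex.choose_spec, by simp only [A, dif_pos h0, if_neg hg, dif_pos hex]⟩
    obtain ⟨i, hi, hAi⟩ := hA
    refine ⟨i, ?_, fun t => by rw [hAi]; exact hi t⟩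
    have hpre : (fun s => S (padIndex hn i (Fin.castLE h0 s))) = fun s => S (i s) := by
      funext s
      simp [padIndex]
    have hg : good n (fun t => S (padIndex hn i t)) (Fin.castLE h0) := by
      intro t
      rw [hpre]
      exact hi _
    rw [hAi]
    simp only [A, dif_pos h0, if_pos hg]
    rw [hpre]

/-! ### Generalization by compression. -/

theorem padIndex_mem {m n : ℕ} (hn : 0 < n) (i : Fin m → Fin n) (t : Fin n) :
    padIndex hn i t ∈ insert ⟨0, hn⟩ (Finset.univ.image i) := by
  unfold padIndex
  split_ifs <;> simp

/-- Replacing some coordinates of a random vector by those of an independent copy does not change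
its distribution. -/
theorem measurePreserving_piecewise {Z ι : Type*} [MeasurableSpace Z] [Fintype ι] [DecidableEq ι]
    (D : Measure Z) [IsProbabilityMeasure D] (R : Finset ι) :
    MeasurePreserving (fun p : (ι → Z) × (ι → Z) => R.piecewise p.1 p.2)
      ((Measure.pi fun _ => D).prod (Measure.pi fun _ => D)) (Measure.pi fun _ => D) := by
  have hm : Measurable (fun p : (ι → Z) × (ι → Z) => R.piecewise p.1 p.2) := by
    refine measurable_pi_lambda _ fun j => ?_
    by_cases hj : j ∈ R
    · simp only [Finset.piecewise_eq_of_mem _ _ _ hj]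
      fun_prop
    · simp only [Finset.piecewise_eq_of_notMem _ _ _ hj]
      fun_prop
  refine ⟨hm, (Measure.pi_eq fun s hs => ?_).symm⟩
  rw [Measure.map_apply hm (MeasurableSet.univ_pi hs)]
  have hpre : (fun p : (ι → Z) × (ι → Z) => R.piecewise p.1 p.2) ⁻¹' Set.univ.pi s
      = (Set.univ.pi fun j => if j ∈ R then s j else Set.univ) ×ˢ
        (Set.univ.pi fun j => if j ∈ R then Set.univ else s j) := by
    ext p
    simp only [Set.mem_preimage, Set.mem_pi, Set.mem_univ, true_imp_iff, Set.mem_prod]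
    rw [← forall_and]
    refine forall_congr' fun j => ?_
    by_cases hj : j ∈ R <;> simp [hj]
  rw [hpre, Measure.prod_prod, Measure.pi_pi, Measure.pi_pi, ← Finset.prod_mul_distrib]
  refine Finset.prod_congr rfl fun j _ => ?_
  by_cases hj : j ∈ R <;> simp [hj]

/-- A measurable hull differs from `s` by a null set, almost all of whose sections are null. The
events below are only known to be null-measurable. -/
theorem measure_prod_of_nullMeasurableSet {α β : Type*} [MeasurableSpace α] [MeasurableSpace β]
    {μ : Measure α} {ν : Measure β} [SFinite ν] {s : Set (α × β)}
    (hs : NullMeasurableSet s (μ.prod ν)) : μ.prod ν s = ∫⁻ a, ν (Prod.mk a ⁻¹' s) ∂μ := by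
  obtain ⟨t, -, ht, hts⟩ := hs.exists_measurable_superset_ae_eq
  rw [← measure_congr hts, Measure.prod_apply ht]
  refine lintegral_congr_ae ?_
  filter_upwards [Measure.ae_ae_of_ae_prod (Filter.eventuallyEq_set.1 hts)] with a ha
  exact measure_congr (Filter.eventuallyEq_set.2 ha)

/-- A hypothesis that depends on the sample coordinates in `R` only is unlikely to be accurate
on the other coordinates while its accuracy under `D` is less than `1 - η`. -/
theorem measure_consistent_inaccurate_le {Z ι : Type*} [MeasurableSpace Z] [Fintype ι]
    [DecidableEq ι] (D : Measure Z) [IsProbabilityMeasure D] (R : Finset ι)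
    (g : (ι → Z) → Z → ℝ) (γ η : ℝ)
    (hR : ∀ a b : ι → Z, (∀ j ∈ R, a j = b j) → g a = g b)
    (hg : AEMeasurable (fun p : (ι → Z) × Z => g p.1 p.2) ((Measure.pi fun _ => D).prod D))
    (hgj : ∀ j, AEMeasurable (fun a : ι → Z => g a (a j)) (Measure.pi fun _ => D)) :
    (Measure.pi fun _ : ι => D)
        {a | (∀ j, g a (a j) ≤ γ) ∧ D {z | g a z ≤ γ} < ENNReal.ofReal (1 - η)}
      ≤ ENNReal.ofReal (Real.exp (-η)) ^ (Fintype.card ι - R.card) := by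
  classical
  set μ : Measure (ι → Z) := Measure.pi fun _ => D with hμ
  have hB : NullMeasurableSet {a | (∀ j ∉ R, g a (a j) ≤ γ) ∧
      D {z | g a z ≤ γ} < ENNReal.ofReal (1 - η)} μ := by
    have h1 : NullMeasurableSet {a | ∀ j ∉ R, g a (a j) ≤ γ} μ := by
      simp only [Set.ofPred_forall]
      refine NullMeasurableSet.iInter fun j => NullMeasurableSet.iInter fun _ => ?_
      exact nullMeasurableSet_le (hgj j) aemeasurable_const
    have h2 : AEMeasurable (fun a => D {z | g a z ≤ γ}) μ := by
      refine ⟨fun a => D {z | hg.mk _ (a, z) ≤ γ}, ?_, ?_⟩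
      · exact measurable_measure_prodMk_left (measurableSet_le hg.measurable_mk measurable_const)
      · filter_upwards [Measure.ae_ae_of_ae_prod hg.ae_eq_mk] with a ha
        refine measure_congr (Filter.eventuallyEq_set.2 ?_)
        filter_upwards [ha] with z hz
        simp only [hz]
    exact h1.inter (nullMeasurableSet_lt h2 aemeasurable_const)
  calc μ {a | (∀ j, g a (a j) ≤ γ) ∧ D {z | g a z ≤ γ} < ENNReal.ofReal (1 - η)}
      ≤ μ {a | (∀ j ∉ R, g a (a j) ≤ γ) ∧ D {z | g a z ≤ γ} < ENNReal.ofReal (1 - η)} :=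
        measure_mono fun a ha => ⟨fun j _ => ha.1 j, ha.2⟩
    -- Resampling the coordinates outside `R` leaves the hypothesis fixed, so the remaining examples
    -- are fresh and independent of it.
    _ = (μ.prod μ) ((fun p : (ι → Z) × (ι → Z) => R.piecewise p.1 p.2) ⁻¹'
          {a | (∀ j ∉ R, g a (a j) ≤ γ) ∧ D {z | g a z ≤ γ} < ENNReal.ofReal (1 - η)}) :=
        ((measurePreserving_piecewise D R).measure_preimage hB).symm
    _ = ∫⁻ a, μ (Prod.mk a ⁻¹' ((fun p : (ι → Z) × (ι → Z) => R.piecewise p.1 p.2) ⁻¹'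
          {a | (∀ j ∉ R, g a (a j) ≤ γ) ∧ D {z | g a z ≤ γ} < ENNReal.ofReal (1 - η)})) ∂μ := by
        have hN := hB.preimage (measurePreserving_piecewise D R).quasiMeasurePreserving
        exact measure_prod_of_nullMeasurableSet hN
    _ ≤ ∫⁻ _, ENNReal.ofReal (Real.exp (-η)) ^ (Fintype.card ι - R.card) ∂μ := by
        refine lintegral_mono fun a => ?_
        have hga : ∀ b, g (R.piecewise a b) = g a := fun b =>
          hR _ _ fun j hj => Finset.piecewise_eq_of_mem _ _ _ hj
        by_cases hlt : D {z | g a z ≤ γ} < ENNReal.ofReal (1 - η)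
        · have hsub : (Prod.mk a ⁻¹' ((fun p : (ι → Z) × (ι → Z) => R.piecewise p.1 p.2) ⁻¹'
              {a | (∀ j ∉ R, g a (a j) ≤ γ) ∧ D {z | g a z ≤ γ} < ENNReal.ofReal (1 - η)}))
              ⊆ Set.univ.pi fun j => if j ∈ R then Set.univ else {z | g a z ≤ γ} := by
            intro b hb j _
            by_cases hj : j ∈ R
            · simp [hj]
            · have := hb.1 j hj
              simp only [hga, Finset.piecewise_eq_of_notMem _ _ _ hj] at this
              simpa [hj] using this
          refine (measure_mono hsub).trans ?_
          rw [hμ, Measure.pi_pi]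
          have hprod : ∏ j, D (if j ∈ R then Set.univ else {z | g a z ≤ γ})
              = D {z | g a z ≤ γ} ^ (Fintype.card ι - R.card) := by
            rw [← Finset.card_compl, ← Finset.prod_const, ← Finset.prod_subset (Finset.subset_univ Rᶜ)]
            · refine Finset.prod_congr rfl fun j hj => ?_
              rw [if_neg (Finset.mem_compl.1 hj)]
            · intro j _ hj
              rw [if_pos (by simpa using hj), measure_univ]
          rw [hprod]
          gcongr
          refine hlt.le.trans (ENNReal.ofReal_le_ofReal ?_)
          linarith [Real.add_one_le_exp (-η)]
        · have : (Prod.mk a ⁻¹' ((fun p : (ι → Z) × (ι → Z) => R.piecewise p.1 p.2) ⁻¹'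
              {a | (∀ j ∉ R, g a (a j) ≤ γ) ∧ D {z | g a z ≤ γ} < ENNReal.ofReal (1 - η)})) = ∅ := by
            ext b
            simp only [Set.mem_preimage, Set.mem_ofPred_eq, hga, Set.mem_empty_iff_false, iff_false]
            exact fun h => hlt h.2
          rw [this]
          simp
    _ = _ := by simp [hμ]

/-- A sample with a test point is an i.i.d. sample of size `n + 1`, the test point at index `0`; `q`
allows for repeated examples. -/
theorem MeasurableAlong.aemeasurable_prod {X : Type*} [MeasurableSpace X] {k : ℕ}
    {A : Learner X k} {D : Measure (X × unitInterval)} [IsProbabilityMeasure D]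
    (hA : MeasurableAlong A D) {n : ℕ} (q : Fin n → Fin n) :
    AEMeasurable (fun p : (Fin n → X × unitInterval) × (X × unitInterval) =>
      listLoss (A n (fun t => p.1 (q t)) p.2.1) p.2.2) ((Measure.pi fun _ => D).prod D) := by
  have h1 := hA (n + 1) n (fun t => (q t).succ) 0
  have h2 := (measurePreserving_piFinSuccAbove (fun _ : Fin (n + 1) => D) 0).symm
  have h3 : MeasurePreserving Prod.swap ((Measure.pi fun _ : Fin n => D).prod D)
    (D.prod (Measure.pi fun _ : Fin n => D)) := Measure.measurePreserving_swap
  have h4 : MeasurePreserving (fun p : (Fin n → X × unitInterval) × (X × unitInterval) =>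
      (Fin.cons p.2 p.1 : Fin (n + 1) → X × unitInterval))
      ((Measure.pi fun _ => D).prod D) (Measure.pi fun _ => D) := by
    convert h2.comp h3 using 1
    funext p
    simp only [Function.comp_apply, MeasurableEquiv.piFinSuccAbove_symm_apply]
    exact (Fin.insertNth_zero' p.2 p.1).symm
  simpa only [Function.comp_def, Fin.cons_succ, Fin.cons_zero] using
    h1.comp_quasiMeasurePreserving h4.quasiMeasurePreserving

theorem MeasurableAlong.ae_aestronglyMeasurable {X : Type*} [MeasurableSpace X] {k : ℕ}
    {A : Learner X k} {D : Measure (X × unitInterval)} [IsProbabilityMeasure D]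
    (hA : MeasurableAlong A D) (n : ℕ) :
    ∀ᵐ S ∂(Measure.pi fun _ : Fin n => D),
      AEStronglyMeasurable (fun z : X × unitInterval => listLoss (A n S z.1) z.2) D :=
  (hA.aemeasurable_prod (n := n) id).aestronglyMeasurable.prodMk_left

theorem ErrorLE.mono {X : Type*} [MeasurableSpace X] {k : ℕ} {D : Measure (X × unitInterval)}
    {μ : X → Fin k → unitInterval} {b b' : ℝ} (h : ErrorLE D μ b) (hb : b ≤ b') :
    ErrorLE D μ b' :=
  ⟨h.1, h.2.trans hb⟩

theorem LearnsWithin.mono {X : Type*} [MeasurableSpace X] {k : ℕ} {A : Learner X k}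
    {D : Measure (X × unitInterval)} {n : ℕ} {b b' δ : ℝ} (h : LearnsWithin A D n b δ)
    (hb : b ≤ b') : LearnsWithin A D n b' δ :=
  (measure_mono fun _ hS => mt (fun hS' => ErrorLE.mono hS' hb) hS).trans h

/-- A hypothesis with accuracy at least `1 - η` at scale `γ` has error at most `γ + η`. -/
theorem errorLE_of_accuracy {X : Type*} [MeasurableSpace X] {k : ℕ} (hk : 1 ≤ k)
    {D : Measure (X × unitInterval)} [IsProbabilityMeasure D] {μ : X → Fin k → unitInterval}
    (hm : AEStronglyMeasurable (fun z : X × unitInterval => listLoss (μ z.1) z.2) D)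
    {γ η : ℝ} (hγ : 0 ≤ γ) (hγ1 : γ ≤ 1) (hη : 0 ≤ η)
    (h : ENNReal.ofReal (1 - η) ≤ D {z | listLoss (μ z.1) z.2 ≤ γ}) : ErrorLE D μ (γ + η) := by
  have hloss : Integrable (fun z : X × unitInterval => listLoss (μ z.1) z.2) D := by
    refine Integrable.of_bound hm 1 (Filter.Eventually.of_forall fun z => ?_)
    rw [Real.norm_eq_abs, abs_of_nonneg (listLoss_nonneg _ _)]
    exact listLoss_le_one hk _ _
  refine ⟨hloss, ?_⟩
  set G : Set (X × unitInterval) := {z | listLoss (μ z.1) z.2 ≤ γ}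
  have hG : NullMeasurableSet G D := nullMeasurableSet_le hm.aemeasurable aemeasurable_const
  have hGreal : 1 - η ≤ D.real G := by
    rw [measureReal_def]
    exact (ENNReal.ofReal_le_iff_le_toReal (measure_ne_top _ _)).1 h
  have hind : Integrable (G.indicator fun _ => (1 - γ : ℝ)) D :=
    (integrable_const _).indicator₀ hG
  calc ∫ z, listLoss (μ z.1) z.2 ∂D ≤ ∫ z, (1 - G.indicator (fun _ => (1 - γ : ℝ)) z) ∂D := by
        refine integral_mono hloss ((integrable_const _).sub hind) fun z => ?_
        by_cases hz : z ∈ G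
        · simp only [Set.indicator_of_mem hz]
          have : listLoss (μ z.1) z.2 ≤ γ := hz
          linarith
        · simp only [Set.indicator_of_notMem hz, sub_zero]
          exact listLoss_le_one hk _ _
    _ = 1 - D.real G * (1 - γ) := by
        rw [integral_sub (integrable_const _) hind, integral_indicator₀ hG]
        simp
    _ ≤ γ + η := by nlinarith

/-- Losses never exceed one. This settles samples too small for compression. -/
theorem learnsWithin_of_one_le {X : Type*} [MeasurableSpace X] {k : ℕ} (hk : 1 ≤ k)
    {A : Learner X k} {D : Measure (X × unitInterval)} [IsProbabilityMeasure D]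
    (hA : MeasurableAlong A D) {n : ℕ} {b δ : ℝ} (hb : 1 ≤ b) : LearnsWithin A D n b δ := by
  refine le_trans (le_of_eq ?_) (zero_le)
  rw [← ae_iff]
  filter_upwards [hA.ae_aestronglyMeasurable n] with S hS
  exact (errorLE_of_accuracy (γ := 0) (η := 1) hk hS le_rfl zero_le_one zero_le_one
    (by simp)).mono (by linarith)

/-- The generalization bound for learners whose output is determined by `m` of the `n` examples
and is accurate at scale `γ` on the sample. -/
theorem learnsWithin_of_compression {X : Type*} [MeasurableSpace X] {H : Set (X → unitInterval)}
    {k : ℕ} (hk : 1 ≤ k) {A : Learner X k} {D : Measure (X × unitInterval)}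
    [IsProbabilityMeasure D] (hD : Realizable H D) (hA : MeasurableAlong A D) {γ δ : ℝ}
    (hγ : 0 ≤ γ) (hγ1 : γ ≤ 1) (hδ : 0 < δ) (hδ1 : δ ≤ 1) {m n : ℕ} (hn : 0 < n) (hmn : 4 * m ≤ n)
    (hdep : m = 0 → ∀ S S', A n S = A n S')
    (hcomp : ∀ S : Fin n → X × unitInterval, (∃ h ∈ H, ∀ t, (S t).2 = h (S t).1) →
      ∃ i : Fin m → Fin n, A n S = A n (fun t => S (padIndex hn i t)) ∧
        ∀ t, listLoss (A n S (S t).1) (S t).2 ≤ γ) :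
    LearnsWithin A D n (γ + 2 * (m * Real.log n + Real.log (1 / δ)) / n) δ := by
  classical
  obtain ⟨h, hH, hh⟩ := hD
  have hn' : (0 : ℝ) < n := by exact_mod_cast hn
  have hlogn : 0 ≤ Real.log n := Real.log_natCast_nonneg n
  have hlogδ : 0 ≤ Real.log (1 / δ) := Real.log_nonneg (by rw [le_div_iff₀ hδ]; linarith)
  -- Chosen so that `n ^ m * exp (-η n / 2) = δ`, which closes the union bound.
  set η : ℝ := 2 * (m * Real.log n + Real.log (1 / δ)) / n with hη
  have hη0 : 0 ≤ η := by positivity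
  set g : (Fin m → Fin n) → (Fin n → X × unitInterval) → X × unitInterval → ℝ := fun i S z =>
    listLoss (A n (fun t => S (padIndex hn i t)) z.1) z.2 with hg
  set B : (Fin m → Fin n) → Set (Fin n → X × unitInterval) := fun i =>
    {S | (∀ j, g i S (S j) ≤ γ) ∧ D {z | g i S z ≤ γ} < ENNReal.ofReal (1 - η)} with hB
  have hBle : ∀ i, (Measure.pi fun _ : Fin n => D) (B i)
      ≤ ENNReal.ofReal (Real.exp (-(m * Real.log n + Real.log (1 / δ)))) := by
    intro i
    -- Padding also reads example `0`, whence `m + 1 ≤ 2m` for `m > 0`. For `m = 0` the output is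
    -- constant and `R` must be empty. Either way at least `n / 2` examples stay fresh.
    set R : Finset (Fin n) := if m = 0 then ∅ else insert ⟨0, hn⟩ (Finset.univ.image i) with hRdef
    have hRcard : R.card ≤ 2 * m := by
      rw [hRdef]
      split_ifs with h0
      · simp
      · have h1 := Finset.card_insert_le (⟨0, hn⟩ : Fin n) (Finset.univ.image i)
        have h2 : (Finset.univ.image i).card ≤ m := Finset.card_image_le.trans (by simp)
        omega
    have hdepR : ∀ a b : Fin n → X × unitInterval, (∀ j ∈ R, a j = b j) → g i a = g i b := by
      intro a b hab
      by_cases h0 : m = 0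
      · funext z
        simp only [hg]
        rw [hdep h0]
      · have : (fun t => a (padIndex hn i t)) = fun t => b (padIndex hn i t) := by
          funext t
          refine hab _ ?_
          rw [hRdef, if_neg h0]
          exact padIndex_mem hn i t
        simp only [hg, this]
    refine (measure_consistent_inaccurate_le D R (g i) γ η hdepR
      (hA.aemeasurable_prod (padIndex hn i)) (fun j => hA n n (padIndex hn i) j)).trans ?_
    rw [← ENNReal.ofReal_pow (Real.exp_pos _).le, ← Real.exp_nat_mul]
    refine ENNReal.ofReal_le_ofReal (Real.exp_le_exp.2 ?_)
    rw [Fintype.card_fin]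
    have h3 : (n : ℝ) / 2 ≤ ((n - R.card : ℕ) : ℝ) := by
      rw [div_le_iff₀ (by norm_num)]
      have : n ≤ (n - R.card) * 2 := by omega
      exact_mod_cast this
    have h4 : (n : ℝ) / 2 * η = m * Real.log n + Real.log (1 / δ) := by
      rw [hη]
      field_simp
    nlinarith [mul_le_mul_of_nonneg_right h3 hη0]
  have hae : ∀ᵐ S ∂(Measure.pi fun _ : Fin n => D),
      S ∉ {S | ¬ ErrorLE D (A n S) (γ + η)} \ ⋃ i, B i := by
    have h1 : ∀ᵐ S ∂(Measure.pi fun _ : Fin n => D), ∀ t, (S t).2 = h (S t).1 :=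
      ae_all_iff.2 fun t =>
        (measurePreserving_eval (fun _ : Fin n => D) t).quasiMeasurePreserving.ae hh
    filter_upwards [h1, hA.ae_aestronglyMeasurable n] with S hS hSm
    rintro ⟨hbad, hSB⟩
    refine hbad ?_
    obtain ⟨i, hi, hcons⟩ := hcomp S ⟨h, hH, hS⟩
    refine errorLE_of_accuracy hk hSm hγ hγ1 hη0 (not_lt.1 fun hlt => hSB ?_)
    refine Set.mem_iUnion.2 ⟨i, fun j => ?_, ?_⟩
    · simp only [hg, ← hi]
      exact hcons j
    · simpa only [hg, ← hi] using hlt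
  calc (Measure.pi fun _ : Fin n => D) {S | ¬ ErrorLE D (A n S) (γ + η)}
      ≤ (Measure.pi fun _ : Fin n => D) (⋃ i, B i) := by
        refine measure_mono_ae ?_
        filter_upwards [hae] with S hS hbad
        by_contra hcon
        exact hS ⟨hbad, hcon⟩
    _ ≤ ∑ i, (Measure.pi fun _ : Fin n => D) (B i) := measure_iUnion_fintype_le _ _
    _ ≤ ∑ _i : Fin m → Fin n,
          ENNReal.ofReal (Real.exp (-(m * Real.log n + Real.log (1 / δ)))) :=
        Finset.sum_le_sum fun i _ => hBle i
    _ = ENNReal.ofReal ((n : ℝ) ^ m *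
          Real.exp (-(m * Real.log n + Real.log (1 / δ)))) := by
        rw [ENNReal.ofReal_mul (by positivity), ENNReal.ofReal_pow hn'.le, ENNReal.ofReal_natCast]
        simp
    _ = ENNReal.ofReal δ := by
        congr 1
        rw [neg_add, Real.exp_add, Real.log_div one_ne_zero hδ.ne', Real.log_one, zero_sub, neg_neg,
          Real.exp_log hδ, Real.exp_neg, Real.exp_nat_mul, Real.exp_log hn']
        field_simp

/-! ### The error bound at a fixed scale. -/

theorem not_oigShatters_succ {X : Type*} {H : Set (X → unitInterval)} {k : ℕ} {γ : ℝ}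
    (h : oigDim H k γ ≠ ⊤) : ¬ OIGShatters H k γ ((oigDim H k γ).toNat + 1) := by
  intro hs
  have h1 : (((oigDim H k γ).toNat + 1 : ℕ) : ℕ∞) ≤ oigDim H k γ :=
    le_iSup (fun n : {n : ℕ // OIGShatters H k γ n} => ((n : ℕ) : ℕ∞)) ⟨_, hs⟩
  have h2 := ENat.toNat_le_toNat h1 h
  rw [ENat.toNat_natCast] at h2
  omega

/-- A single learner at a scale `γ` at which the dimension is finite. -/
theorem exists_scale_learner {X : Type*} {H : Set (X → unitInterval)} {k : ℕ} {γ : ℝ}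
    (hk : 1 ≤ k) (hγ : 0 ≤ γ) (hγ1 : γ ≤ 1) (hd : oigDim H k γ ≠ ⊤) :
    ∃ A : Learner X k, ∀ [MeasurableSpace X] (D : Measure (X × unitInterval))
      [IsProbabilityMeasure D], Realizable H D → MeasurableAlong A D →
      ∀ δ ∈ Set.Ioo (0 : ℝ) 1, ∀ n : ℕ, 1 ≤ n →
        LearnsWithin A D n
          (γ + 104 * (k * (oigDim H k γ).toNat * Real.log (n + 1) ^ 2 + Real.log (1 / δ)) / n) δ := by
  set d := (oigDim H k γ).toNat with hdd
  obtain ⟨A, hA0, hA⟩ := exists_compressing_learner hk hγ (not_oigShatters_succ hd)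
    (fun n => ⌈8 * ((k : ℝ) + 1) * Real.log (n + 1)⌉₊) (fun n => Nat.le_ceil _)
  rw [← hdd] at hA0 hA
  refine ⟨A, fun D _ hD hm δ hδ n hn => ?_⟩
  set T := ⌈8 * ((k : ℝ) + 1) * Real.log (n + 1)⌉₊ with hT
  set l := Real.log (n + 1) with hl
  have hn' : (1 : ℝ) ≤ n := by exact_mod_cast hn
  have hk' : (1 : ℝ) ≤ k := by exact_mod_cast hk
  have hl2 : Real.log 2 ≤ l := Real.log_le_log (by norm_num) (by linarith)
  have hlog2 := Real.log_two_gt_d9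
  have hlpos : 0 < l := by linarith
  have hlogδ : 0 ≤ Real.log (1 / δ) :=
    Real.log_nonneg (by rw [le_div_iff₀ hδ.1]; linarith [hδ.2])
  have hTle : (T : ℝ) ≤ 18 * k * l := by
    have h1 : (T : ℝ) < 8 * ((k : ℝ) + 1) * l + 1 := Nat.ceil_lt_add_one (by positivity)
    nlinarith
  have hm1 : ((T * d : ℕ) : ℝ) ≤ 18 * (k * d * l) := by
    push_cast
    have := mul_le_mul_of_nonneg_right hTle (Nat.cast_nonneg (α := ℝ) d)
    linarith
  have hkd : (0 : ℝ) ≤ k * d * l := by positivity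
  have hAn := hA n hn
  rw [← hl, ← hT] at hAn
  by_cases h4 : 4 * (T * d) ≤ n
  · refine (learnsWithin_of_compression (m := T * d) hk hD hm hγ hγ1 hδ.1 hδ.2.le hn h4 ?_
      (hAn (by omega))).mono ?_
    · intro h0 S S'
      have hT0 : T ≠ 0 := (Nat.ceil_pos.2 (by positivity)).ne'
      exact hA0 ((Nat.mul_eq_zero.1 h0).resolve_left hT0) n S S'
    · have hll : Real.log n ≤ l := Real.log_le_log (by linarith) (by linarith)
      have hlogn : 0 ≤ Real.log n := Real.log_natCast_nonneg n
      gcongr γ + ?_ / n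
      have h5 : ((T * d : ℕ) : ℝ) * Real.log n ≤ 18 * (k * d * l) * l := by gcongr
      nlinarith
  -- Here `n < 4 T d ≤ 72 k d l`, and `104 log 2 ≥ 72` makes the claimed bound at least one.
  · refine learnsWithin_of_one_le hk hm ?_
    push Not at h4
    have h5 : (n : ℝ) < 4 * ((T * d : ℕ) : ℝ) := by exact_mod_cast h4
    have h6 : (1 : ℝ) ≤ 104 * (k * d * l ^ 2 + Real.log (1 / δ)) / n := by
      rw [le_div_iff₀ (by linarith)]
      nlinarith
    linarith

/-! ### Inversion of the sample size bound. -/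

/-- With `1 + t = s ^ 4`, `log (1 + t) = 4 log s ≤ 4 s`, so the square is at most `16 √(1 + t)`. -/
theorem log_sq_le_of_large {t : ℝ} (ht : 4000000000 ≤ t) :
    3328 * Real.log (1 + t) ^ 2 ≤ t := by
  set r := √(1 + t) with hr
  set s := √r with hs
  have hr2 : r ^ 2 = 1 + t := Real.sq_sqrt (by linarith)
  have hrbig : 60000 ≤ r := Real.le_sqrt_of_sq_le (by norm_num; linarith)
  have hs2 : s ^ 2 = r := Real.sq_sqrt (by linarith)
  have hspos : 0 < s := Real.sqrt_pos.2 (by linarith)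
  have hlog : Real.log (1 + t) = 4 * Real.log s := by
    rw [← hr2, ← hs2, Real.log_pow, Real.log_pow]
    push_cast
    ring
  have hls : Real.log s ≤ s := Real.log_le_self hspos.le
  have hls0 : 0 ≤ Real.log s := Real.log_nonneg (by nlinarith)
  rw [hlog]
  nlinarith [mul_self_le_mul_self hls0 hls]

/-- Inversion of the sample size bound. -/
theorem log_sq_le_of_sample_size {a ε n : ℝ} (ha : 0 ≤ a) (hε : 0 < ε) (hn0 : 0 ≤ n)
    (hn : 10000000000 * (a * Real.log (2 + a / ε) ^ 2) ≤ ε * n) :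
    832 * (a * Real.log (n + 1) ^ 2) ≤ ε * n := by
  rcases ha.eq_or_lt with rfl | ha
  · simp only [zero_mul, mul_zero]
    positivity
  set b := a / ε with hb
  have hbpos : 0 < b := by positivity
  set L := Real.log (2 + b) with hL
  have hLlow : 0.69 ≤ L := by
    have h1 : Real.log 2 ≤ L := Real.log_le_log (by norm_num) (by linarith)
    linarith [Real.log_two_gt_d9]
  -- Since `n + 1 ≤ (2 + b)(1 + t)`, the logarithm splits into `L`, controlled by the hypothesis,
  -- and `log (1 + t)`, controlled by `t`.
  set t := n / b with ht
  have hnt : n = b * t := by rw [ht]; field_simp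
  have hab : a = ε * b := by rw [hb]; field_simp
  have htL : 10000000000 * L ^ 2 ≤ t := by
    rw [ht, le_div_iff₀ hbpos]
    rw [hab] at hn
    have : ε * (10000000000 * L ^ 2 * b) ≤ ε * n := by linarith
    exact le_of_mul_le_mul_left this hε
  have htbig : 4000000000 ≤ t := by nlinarith
  have h1 := log_sq_le_of_large htbig
  have h2 : Real.log (n + 1) ≤ L + Real.log (1 + t) := by
    rw [hL, ← Real.log_mul (by positivity) (by linarith)]
    refine Real.log_le_log (by linarith) ?_
    rw [hnt]
    nlinarith
  have h3 : 0 ≤ Real.log (n + 1) := Real.log_nonneg (by linarith)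
  have h4 : Real.log (n + 1) ^ 2 ≤ 2 * L ^ 2 + 2 * Real.log (1 + t) ^ 2 := by
    nlinarith [sq_nonneg (L - Real.log (1 + t)), mul_self_le_mul_self h3 h2]
  have h5 : 832 * Real.log (n + 1) ^ 2 ≤ t := by nlinarith
  have h6 := mul_le_mul_of_nonneg_left h5 (mul_pos hε hbpos).le
  have h7 : ε * b * t = ε * n := by rw [hnt]; ring
  rw [hab]
  linarith

/-! ### A learner independent of the accuracy. -/

/-- Raising `γ` can only lower outdegrees, so a witness at the larger scale serves the smaller one.
-/
theorem oigDim_antitone {X : Type*} (H : Set (X → unitInterval)) (k : ℕ) :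
    Antitone (oigDim H k) := by
  intro γ γ' hγ
  refine iSup_le fun n => ?_
  obtain ⟨n, S, V, hV, hVH, hσ⟩ := n
  refine le_iSup (fun n : {n : ℕ // OIGShatters H k γ n} => ((n : ℕ) : ℕ∞))
    ⟨n, S, V, hV, hVH, fun σ h => ?_⟩
  obtain ⟨v, hv, hle⟩ := hσ σ h
  refine ⟨v, hv, hle.trans (Nat.cast_le.2 (Set.ncard_le_ncard ?_ (Set.toFinite _)))⟩
  rintro i hi ⟨w, hw, hwi⟩
  exact hi ⟨w, hw, hwi.trans hγ⟩

/-- If the dimension vanishes at every scale, then at each point the values of the class are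
covered by a single list. -/
theorem exists_exact_list {X : Type*} {H : Set (X → unitInterval)} {k : ℕ} (hk : 1 ≤ k)
    (h : ∀ γ ∈ Set.Ioo (0 : ℝ) 1, oigDim H k γ = 0) (x : X) :
    ∃ μ : Fin k → unitInterval, ∀ f ∈ H, listLoss μ (f x) = 0 := by
  have hscale : ∀ γ ∈ Set.Ioo (0 : ℝ) 1,
      {μ : Fin k → unitInterval | ∀ f ∈ H, listLoss μ (f x) ≤ γ}.Nonempty := by
    intro γ hγ
    have hd := not_oigShatters_succ (H := H) (k := k) (γ := γ) (by rw [h γ hγ]; simp)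
    rw [h γ hγ] at hd
    obtain ⟨P, hP⟩ := exists_predictor hk hd fun _ => x
    refine ⟨P 0 fun _ => 0, fun f hf => ?_⟩
    by_contra hcon
    have h1 := hP f hf
    have h2 : (Finset.univ.filter fun a => γ < listLoss (P a fun _ => f x) (f x)).card ≠ 0 := by
      refine Finset.card_ne_zero.2 ⟨0, Finset.mem_filter.2 ⟨Finset.mem_univ _, ?_⟩⟩
      -- With a single position nothing is observed, so one list serves all of `H`, and the mistake
      -- bound permits no mistake.
      have : (fun _ => f x : {j : Fin (ENat.toNat 0 + 1) // j ≠ 0} → unitInterval) = fun _ => 0 :=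
        funext fun j => absurd (Fin.ext (by have := j.1.2; simp at this ⊢)) j.2
      rw [this]
      exact not_le.1 hcon
    simp only [ENat.toNat_zero] at h1 h2
    have h3 := Nat.one_le_iff_ne_zero.2 h2
    nlinarith
  have hclosed : ∀ γ, IsClosed {μ : Fin k → unitInterval | ∀ f ∈ H, listLoss μ (f x) ≤ γ} := by
    intro γ
    simp only [Set.ofPred_forall]
    exact isClosed_iInter fun f => isClosed_iInter fun _ => isClosed_listLoss_le hk _ _
  -- Nested compact sets as the scale tends to `0`; `m + 2` keeps the scales below `1`.
  obtain ⟨μ, hμ⟩ := IsCompact.nonempty_iInter_of_sequence_nonempty_isCompact_isClosed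
    (fun m : ℕ => {μ : Fin k → unitInterval | ∀ f ∈ H, listLoss μ (f x) ≤ 1 / ((m : ℝ) + 2)})
    (fun m μ hμ f hf => (hμ f hf).trans (by push_cast; gcongr; linarith))
    (fun m => hscale _ ⟨by positivity, by
      rw [div_lt_one (by positivity)]
      linarith [Nat.cast_nonneg (α := ℝ) m]⟩)
    (hclosed _).isCompact (fun m => hclosed _)
  refine ⟨μ, fun f hf => le_antisymm (le_of_forall_pos_le_add fun ε hε => ?_) (listLoss_nonneg _ _)⟩
  obtain ⟨m, hm⟩ := exists_nat_one_div_lt hε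
  have h1 := Set.mem_iInter.1 hμ m f hf
  have h2 : 1 / ((m : ℝ) + 2) ≤ 1 / ((m : ℝ) + 1) := by gcongr; linarith
  linarith

theorem learnsWithin_of_exact {X : Type*} [MeasurableSpace X] {H : Set (X → unitInterval)} {k : ℕ}
    {A : Learner X k} (hA : ∀ n S x, ∀ f ∈ H, listLoss (A n S x) (f x) = 0)
    {D : Measure (X × unitInterval)} (hD : Realizable H D) {n : ℕ} {b δ : ℝ} (hb : 0 ≤ b) :
    LearnsWithin A D n b δ := by
  obtain ⟨h, hH, hh⟩ := hD
  have hE : ∀ S, ErrorLE D (A n S) b := by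
    intro S
    have h0 : (fun z : X × unitInterval => listLoss (A n S z.1) z.2) =ᵐ[D] fun _ => 0 := by
      filter_upwards [hh] with z hz
      rw [hz]
      exact hA n S z.1 h hH
    exact ⟨(integrable_zero _ _ _).congr h0.symm, by rw [integral_congr_ae h0]; simpa using hb⟩
  simp [LearnsWithin, hE]

/-- The learners at all scales. If the dimension vanishes at every scale, they are exact. -/
theorem exists_learner_family {X : Type*} [MeasurableSpace X] (H : Set (X → unitInterval)) {k : ℕ}
    (hk : 1 ≤ k) :
    ∃ A : ℝ → Learner X k,
      (∀ γ ∈ Set.Ioo (0 : ℝ) 1, oigDim H k γ ≠ ⊤ →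
        ∀ (D : Measure (X × unitInterval)) [IsProbabilityMeasure D],
          Realizable H D → MeasurableAlong (A γ) D →
          ∀ δ ∈ Set.Ioo (0 : ℝ) 1, ∀ n : ℕ, 1 ≤ n →
            LearnsWithin (A γ) D n (γ + 104 *
              (k * (oigDim H k γ).toNat * Real.log (n + 1) ^ 2 + Real.log (1 / δ)) / n) δ) ∧
      ((∀ γ ∈ Set.Ioo (0 : ℝ) 1, oigDim H k γ = 0) →
        ∀ γ n S x, ∀ f ∈ H, listLoss (A γ n S x) (f x) = 0) := by
  by_cases hex : ∀ γ ∈ Set.Ioo (0 : ℝ) 1, oigDim H k γ = 0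
  · choose μ hμ using exists_exact_list hk hex
    refine ⟨fun _ _ _ => μ, fun γ hγ _ D _ hD _ δ hδ n hn => ?_, fun _ _ _ _ => hμ⟩
    refine learnsWithin_of_exact (fun _ _ => hμ) hD ?_
    have hlogδ : 0 ≤ Real.log (1 / δ) :=
      Real.log_nonneg (by rw [le_div_iff₀ hδ.1]; linarith [hδ.2])
    have := hγ.1
    positivity
  · have hscale : ∀ γ, ∃ A : Learner X k, γ ∈ Set.Ioo (0 : ℝ) 1 → oigDim H k γ ≠ ⊤ →
        ∀ (D : Measure (X × unitInterval)) [IsProbabilityMeasure D],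
          Realizable H D → MeasurableAlong A D →
          ∀ δ ∈ Set.Ioo (0 : ℝ) 1, ∀ n : ℕ, 1 ≤ n →
            LearnsWithin A D n (γ + 104 *
              (k * (oigDim H k γ).toNat * Real.log (n + 1) ^ 2 + Real.log (1 / δ)) / n) δ := by
      intro γ
      by_cases h : γ ∈ Set.Ioo (0 : ℝ) 1 ∧ oigDim H k γ ≠ ⊤
      · obtain ⟨A, hA⟩ := exists_scale_learner hk h.1.1.le h.1.2.le h.2
        exact ⟨A, fun _ _ => hA⟩
      · exact ⟨fun _ _ _ _ => 0, fun h1 h2 => absurd ⟨h1, h2⟩ h⟩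
    choose A hA using hscale
    exact ⟨A, hA, fun h => absurd h hex⟩

/-- The accuracies `ε` that are within reach of samples of size `n`. -/
def attainable {X : Type*} (H : Set (X → unitInterval)) (k n : ℕ) : Set ℝ :=
  {ε | ε ∈ Set.Ioo (0 : ℝ) 1 ∧ oigDim H k (1 / 8 * ε) ≠ ⊤ ∧
    10000000000 * (k * (oigDim H k (1 / 8 * ε)).toNat *
      Real.log (2 + k * (oigDim H k (1 / 8 * ε)).toNat / ε) ^ 2) ≤ ε * n}

/-- Up to a factor of two there is a best attainable accuracy, unless the dimension vanishes at
every scale. -/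
theorem exists_attainable_le {X : Type*} {H : Set (X → unitInterval)} {k n : ℕ} (hk : 1 ≤ k)
    (hne : (attainable H k n).Nonempty)
    (hdim : ¬ ∀ γ ∈ Set.Ioo (0 : ℝ) 1, oigDim H k γ = 0) :
    ∃ ε' ∈ attainable H k n, ∀ ε ∈ attainable H k n, ε' ≤ 2 * ε := by
  have hbdd : BddBelow (attainable H k n) := ⟨0, fun ε hε => hε.1.1.le⟩
  rcases (le_csInf hne fun ε hε => hε.1.1.le).eq_or_lt with h0 | hpos
  · refine absurd (fun γ hγ => ?_) hdim
    obtain ⟨ε, hε, hlt⟩ := exists_lt_of_csInf_lt hne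
      (show sInf (attainable H k n) < min γ (1 / ((n : ℝ) + 1)) by
        rw [← h0]; exact lt_min hγ.1 (by positivity))
    obtain ⟨hε01, htop, hle⟩ := hε
    set d := (oigDim H k (1 / 8 * ε)).toNat with hd
    have hε0 := hε01.1
    have h1 : ε * n < 1 := by
      have h2 := hlt.trans_le (min_le_right _ _)
      rw [lt_div_iff₀ (by positivity)] at h2
      linarith
    have hL : 0.69 ≤ Real.log (2 + k * d / ε) := by
      have h2 : Real.log 2 ≤ Real.log (2 + k * d / ε) :=
        Real.log_le_log (by norm_num) (le_add_of_nonneg_right (by positivity))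
      linarith [Real.log_two_gt_d9]
    have hL2 : (0.4 : ℝ) ≤ Real.log (2 + k * d / ε) ^ 2 := by nlinarith
    -- Now `ε n < 1`, so attainability leaves no room for `d ≥ 1`; antitonicity carries the
    -- vanishing up to `γ`.
    have hd0 : d = 0 := by
      by_contra hcon
      have h3 : (1 : ℝ) ≤ d := by exact_mod_cast Nat.one_le_iff_ne_zero.2 hcon
      have h4 : (1 : ℝ) ≤ k := by exact_mod_cast hk
      have h5 : (1 : ℝ) ≤ k * d := by nlinarith
      nlinarith
    have hz : oigDim H k (1 / 8 * ε) = 0 := by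
      rw [← ENat.natCast_toNat htop, ← hd, hd0, Nat.cast_zero]
    refine le_antisymm (hz ▸ oigDim_antitone H k ?_) zero_le
    linarith [hlt.trans_le (min_le_left _ _)]
  · obtain ⟨ε', hε', hlt⟩ := exists_lt_of_csInf_lt hne
      (show sInf (attainable H k n) < 2 * sInf (attainable H k n) by linarith)
    exact ⟨ε', hε', fun ε hε => hlt.le.trans (by linarith [csInf_le hbdd hε])⟩

theorem attainable_bound {X : Type*} {H : Set (X → unitInterval)} {k n : ℕ} (hn : 1 ≤ n) {ε : ℝ}
    (hε : ε ∈ attainable H k n) :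
    104 * (k * (oigDim H k (1 / 8 * ε)).toNat * Real.log (n + 1) ^ 2) / n ≤ ε / 8 := by
  obtain ⟨hε01, -, hle⟩ := hε
  have h := log_sq_le_of_sample_size (by positivity) hε01.1 (Nat.cast_nonneg n) hle
  have hn' : (0 : ℝ) < n := by exact_mod_cast hn
  rw [div_le_iff₀ hn']
  linarith

/-- A sample size that meets the bound makes `ε` attainable and controls the confidence term. -/
theorem attainable_of_sample_size {X : Type*} {H : Set (X → unitInterval)} {k n : ℕ} {ε δ : ℝ}
    (hε : ε ∈ Set.Ioo (0 : ℝ) 1) (hδ : δ ∈ Set.Ioo (0 : ℝ) 1) (hd : oigDim H k (1 / 8 * ε) ≠ ⊤)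
    (hn : 10000000000 * (k * (oigDim H k (1 / 8 * ε)).toNat *
      Real.log (2 + k * (oigDim H k (1 / 8 * ε)).toNat / ε) ^ 2 + Real.log (1 / δ)) / ε ≤ n) :
    1 ≤ n ∧ ε ∈ attainable H k n ∧ 104 * Real.log (1 / δ) / n ≤ ε / 8 := by
  have hlogδ : 0 < Real.log (1 / δ) :=
    Real.log_pos (by rw [lt_div_iff₀ hδ.1]; linarith [hδ.2])
  have hε0 := hε.1
  have hsq : 0 ≤ (k * (oigDim H k (1 / 8 * ε)).toNat *
      Real.log (2 + k * (oigDim H k (1 / 8 * ε)).toNat / ε) ^ 2 : ℝ) := by positivity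
  have hnpos : (0 : ℝ) < n := lt_of_lt_of_le (by positivity) hn
  rw [div_le_iff₀ hε0] at hn
  refine ⟨by exact_mod_cast hnpos, ⟨hε, hd, by linarith⟩, ?_⟩
  rw [div_le_iff₀ hnpos]
  linarith

end ListRegression

open ListRegression MeasureTheory in
/-- Finite `(γ,k)`-OIG dimension suffices for realizable `k`-list regression. The constants are
absolute; the learner `A γ` depends on `H`, `k` and the scale only, not on `D` or `δ`, and in the
last part the scale `g n` depends on the sample size only. -/
theorem mainTheorem3 :
    ∃ C : ℝ, 0 < C ∧ ∃ c : ℝ, 0 < c ∧ c ≤ 1 ∧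
    ∀ {X : Type*} [MeasurableSpace X] (H : Set (X → unitInterval)) (k : ℕ), 1 ≤ k →
    ∃ (A : ℝ → Learner X k) (g : ℕ → ℝ), (∀ n, g n ∈ Set.Ioo (0 : ℝ) 1) ∧
      -- the error bound at scale `γ`
      (∀ γ ∈ Set.Ioo (0 : ℝ) 1, oigDim H k γ ≠ ⊤ →
        ∀ (D : Measure (X × unitInterval)) [IsProbabilityMeasure D],
          Realizable H D → MeasurableAlong (A γ) D →
          ∀ δ ∈ Set.Ioo (0 : ℝ) 1, ∀ n : ℕ, 1 ≤ n →
            LearnsWithin (A γ) D n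
              (γ + C * (k * (oigDim H k γ).toNat * Real.log (n + 1) ^ 2 + Real.log (1 / δ)) / n)
              δ) ∧
      -- the sample complexity of the learner at scale `γ = c ε`
      (∀ ε ∈ Set.Ioo (0 : ℝ) 1, oigDim H k (c * ε) ≠ ⊤ →
        ∀ (D : Measure (X × unitInterval)) [IsProbabilityMeasure D],
          Realizable H D → MeasurableAlong (A (c * ε)) D →
          ∀ δ ∈ Set.Ioo (0 : ℝ) 1, ∀ n : ℕ,
            C * (k * (oigDim H k (c * ε)).toNat *
                Real.log (2 + k * (oigDim H k (c * ε)).toNat / ε) ^ 2 + Real.log (1 / δ)) / ε ≤ n →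
            LearnsWithin (A (c * ε)) D n ε δ) ∧
      -- the same sample complexity for a single learner that does not depend on `ε`
      (∀ ε ∈ Set.Ioo (0 : ℝ) 1, oigDim H k (c * ε) ≠ ⊤ →
        ∀ (D : Measure (X × unitInterval)) [IsProbabilityMeasure D],
          Realizable H D → (∀ γ ∈ Set.Ioo (0 : ℝ) 1, MeasurableAlong (A γ) D) →
          ∀ δ ∈ Set.Ioo (0 : ℝ) 1, ∀ n : ℕ,
            C * (k * (oigDim H k (c * ε)).toNat *
                Real.log (2 + k * (oigDim H k (c * ε)).toNat / ε) ^ 2 + Real.log (1 / δ)) / ε ≤ n →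
            LearnsWithin (fun m => A (g m) m) D n ε δ) := by
  refine ⟨10000000000, by norm_num, 1 / 8, by norm_num, by norm_num, ?_⟩
  intro X _ H k hk
  obtain ⟨A, hA, hexact⟩ := exists_learner_family H hk
  have hg : ∀ n, ∃ γ ∈ Set.Ioo (0 : ℝ) 1,
      (∃ ε' ∈ attainable H k n, ∀ ε ∈ attainable H k n, ε' ≤ 2 * ε) →
      ∃ ε' ∈ attainable H k n, (∀ ε ∈ attainable H k n, ε' ≤ 2 * ε) ∧ γ = 1 / 8 * ε' := by
    intro n
    by_cases h : ∃ ε' ∈ attainable H k n, ∀ ε ∈ attainable H k n, ε' ≤ 2 * ε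
    · obtain ⟨ε', hε', hmin⟩ := h
      exact ⟨1 / 8 * ε', ⟨by linarith [hε'.1.1], by linarith [hε'.1.2]⟩,
        fun _ => ⟨ε', hε', hmin, rfl⟩⟩
    · exact ⟨1 / 2, by norm_num, fun h' => absurd h' h⟩
  choose g hg01 hg using hg
  have hpos : ∀ δ ∈ Set.Ioo (0 : ℝ) 1, 0 ≤ Real.log (1 / δ) := fun δ hδ =>
    Real.log_nonneg (by rw [le_div_iff₀ hδ.1]; linarith [hδ.2])
  refine ⟨A, g, hg01, ?_, ?_, ?_⟩
  · intro γ hγ hd D _ hD hm δ hδ n hn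
    refine (hA γ hγ hd D hD hm δ hδ n hn).mono ?_
    have := hpos δ hδ
    gcongr
    norm_num
  · intro ε hε hd D _ hD hm δ hδ n hn
    obtain ⟨hn1, hatt, hconf⟩ := attainable_of_sample_size hε hδ hd hn
    refine (hA _ ⟨by linarith [hε.1], by linarith [hε.2]⟩ hd D hD hm δ hδ n hn1).mono ?_
    rw [mul_add, add_div]
    linarith [attainable_bound hn1 hatt, hε.1]
  · intro ε hε hd D _ hD hm δ hδ n hn
    obtain ⟨hn1, hatt, hconf⟩ := attainable_of_sample_size hε hδ hd hn
    -- If the dimension vanishes at every scale, every accuracy is attainable and none is nearly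
    -- best; the learners are then exact.
    by_cases hdim : ∀ γ ∈ Set.Ioo (0 : ℝ) 1, oigDim H k γ = 0
    · exact learnsWithin_of_exact (fun m => hexact hdim (g m) m) hD hε.1.le
    · obtain ⟨ε', hε', hmin, hgn⟩ := hg n (exists_attainable_le hk ⟨ε, hatt⟩ hdim)
      have hd' : oigDim H k (g n) ≠ ⊤ := by rw [hgn]; exact hε'.2.1
      have key := hA (g n) (hg01 n) hd' D hD (hm _ (hg01 n)) δ hδ n hn1
      refine LearnsWithin.mono (A := fun m => A (g m) m) key ?_
      -- Scale and complexity term cost `ε'/8 ≤ ε/4` each, confidence `ε/8`: in total `5ε/8`.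
      rw [mul_add, add_div, hgn]
      linarith [attainable_bound hn1 hε', hmin ε hatt, hε.1]
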